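/- For an integer $N\ge 1$ and real $a,b>0$ put $$\langle f\rangle_{a,b}=\frac1{N!}\int_{[0,1]^N} f(x_1,\dots,x_N)\prod_{i<j}(x_i-x_j)^2\prod_{i=1}^N x_i^{a-1}(1-x_i)^{b-1}\,dx_i ,$$ and for an integer $k\ge 1$ let $I_k=I_k(N;a,b)=\langle p_k\rangle_{a,b}/\langle 1\rangle_{a,b}$, where $p_k=\sum_{i=1}^N x_i^k$. For fixed $N$ and $k$, $I_k(N;a,b)$ is a rational function of $(a,b)$ on the quadrant $a,b>0$; outside this quadrant $I_k(N;a,b)$ denotes the value of that rational function, wherever it is regular. Let $k\ge 1$ be an integer, let $a_0,a_1,b_0,b_1$ be real numbers, and take $a=a_1N+a_0$, $b=b_1N+b_0$. 1. If $a_1=-1$ and $b_1\ne -1$, then $I_k(N;a_1N+a_0,b_1N+b_0)$ is well defined (that is, the rational function is regular at this point and its value there is unique) for all sufficiently large $N$, and $$\lim_{N\to\infty}\frac{I_k(N;a_1N+a_0,\,b_1N+b_0)}{N}=0 .$$ 2. If $b_1=-1$ and $a_1\neq -1$, then $I_k(N;a_1N+a_0,b_1N+b_0)$ is well defined in the same sense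 for all sufficiently large $N$, and $$\lim_{N\to\infty}\frac{I_k(N;a_1N+a_0,\,b_1N+b_0)}{N}=1 .$$ -/

import Mathlib

open Filter Topology

noncomputable section

/-- The unnormalised Jacobi average
`⟨f⟩_{a,b} = (1/N!) ∫_{[0,1]^N} f(x) ∏_{i<j} (x_i - x_j)^2 ∏_i x_i^{a-1} (1-x_i)^{b-1} dx`.
The integrals for `f = 1` converge exactly when `a > 0` and `b > 0`. -/
def jacobiAverage (N : ℕ) (a b : ℝ) (f : (Fin N → ℝ) → ℝ) : ℝ :=
  (1 / (N.factorial : ℝ)) * ∫ x in Set.Icc (0 : Fin N → ℝ) 1,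
    f x * (∏ i, ∏ j ∈ Finset.Ioi i, (x i - x j) ^ 2) *
      ∏ i, (x i ^ (a - 1) * (1 - x i) ^ (b - 1))

/-- The power sum `p_k(x_1, …, x_N) = ∑ x_i^k`. -/
def powerSum (N k : ℕ) (x : Fin N → ℝ) : ℝ := ∑ i, x i ^ k

/-- The ratio of convergent integrals `⟨p_k⟩_{a,b} / ⟨1⟩_{a,b}`, meaningful for `a, b > 0`. -/
def selbergRatio (N k : ℕ) (a b : ℝ) : ℝ :=
  jacobiAverage N a b (powerSum N k) / jacobiAverage N a b (fun _ => 1)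

/-- `c` is the value at `(a, b)` of the rational function of the two parameters that extends
`⟨p_k⟩ / ⟨1⟩` beyond the quadrant of convergence: there is a fraction `P / Q` of real polynomials
in two variables, with `Q a b ≠ 0`, which equals `⟨p_k⟩ / ⟨1⟩` at all points of the open positive
quadrant where `Q` does not vanish, and `c = P a b / Q a b`. -/
def IsContinuedRatio (N k : ℕ) (a b c : ℝ) : Prop :=
  ∃ P Q : MvPolynomial (Fin 2) ℝ,
    MvPolynomial.eval ![a, b] Q ≠ 0 ∧
    (∀ a' b' : ℝ, 0 < a' → 0 < b' → MvPolynomial.eval ![a', b'] Q ≠ 0 →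
      selbergRatio N k a' b' =
        MvPolynomial.eval ![a', b'] P / MvPolynomial.eval ![a', b'] Q) ∧
    c = MvPolynomial.eval ![a, b] P / MvPolynomial.eval ![a, b] Q

open Classical in
/-- `I_k` for `N` variables and real parameters `a, b`: the rational continuation of
`⟨p_k⟩_{a,b} / ⟨1⟩_{a,b}` in the parameters, evaluated at `(a, b)` (and `0` where that continuation
is not regular). -/
def selbergI (N k : ℕ) (a b : ℝ) : ℝ :=
  if h : ∃ c, IsContinuedRatio N k a b c then h.choose else 0

end

/-! The averages of all products of power sums, indexed by multisets of parts, are treated together.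
The divergence of x_i^(m+1) (1 - x_i) p_l Δ² w integrates to zero over the cube, where w is the
Jacobi weight; this gives the loop equations `jacobiMoment_loop`. In total degree n + 1 they form a
linear system with diagonal coefficient a + b - 2 + 2N. The remaining entries come from splitting a
part (`cuts`) or merging two parts (`joins`); they are nonnegative and add up to n in each row. The
right-hand side has degree n.

Regularity: once |a + b - 2 + 2N| exceeds n the matrix is strictly diagonally dominant, so by
induction on the degree Cramer's rule continues every average rationally
(`exists_isRatCont_jacobiMoment`). The coefficient grows like (a₁ + b₁ + 2)N, and the slope is
nonzero in both cases of the theorem.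

Limit: divide each average by N to the number of its parts. Splittings then keep weight one, while
mergings acquire a factor N⁻². Weighting by t^card with t large makes the splittings small as well,
so the system is invertible with a bound uniform in large N (`abs_le_of_top_loop`). Hence the scaled
averages tend to the products ∏ μ over the parts, for any sequence μ with μ 0 = 1 that solves the
limiting recursion (`tendsto_of_loop`). The moments of the point mass at 0 solve it when a₁ = -1,
and those of the point mass at 1 when b₁ = -1. -/

/-! ### Combinatorics of splitting and merging parts -/

/-- All the ways to split one part `m + 1`, sitting next to the parts `l`, into two positive
parts. -/
def cuts (m : ℕ) (l : Multiset ℕ) : Multiset (Multiset ℕ) :=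
  (Multiset.range m).map fun s => (s + 1) ::ₘ (m - s) ::ₘ l

/-- All the ways to enlarge a part `j` of `l` by `k`, each counted `j` times. -/
def joins (k : ℕ) (l : Multiset ℕ) : Multiset (Multiset ℕ) :=
  l.bind fun j => Multiset.replicate j ((j + k) ::ₘ l.erase j)

theorem joins_zero (k : ℕ) : joins k 0 = 0 := by simp [joins]

theorem joins_cons (k a : ℕ) (l : Multiset ℕ) :
    joins k (a ::ₘ l) = Multiset.replicate a ((a + k) ::ₘ l) + (joins k l).map (a ::ₘ ·) := by
  unfold joins
  rw [Multiset.cons_bind, Multiset.erase_cons_head, Multiset.map_bind]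
  congr 1
  refine Multiset.bind_congr fun j hj => ?_
  rw [Multiset.map_replicate, Multiset.cons_swap]
  congr 2
  by_cases h : a = j
  · subst h
    rw [Multiset.erase_cons_head, Multiset.cons_erase hj]
  · rw [Multiset.erase_cons_tail _ h]

/-- Together with `card_cuts` this gives the total off-diagonal weight m + l.sum in a row of the
loop equations. -/
theorem card_joins (k : ℕ) (l : Multiset ℕ) : (joins k l).card = l.sum := by
  simp [joins, Multiset.card_bind]

theorem card_cuts (m : ℕ) (l : Multiset ℕ) : (cuts m l).card = m := by
  simp [cuts]

theorem mem_joins {k : ℕ} {l t : Multiset ℕ} (h : t ∈ joins k l) :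
    ∃ j ∈ l, j ≠ 0 ∧ t = (j + k) ::ₘ l.erase j := by
  obtain ⟨j, hj, ht⟩ := Multiset.mem_bind.1 h
  obtain ⟨h0, h1⟩ := Multiset.mem_replicate.1 ht
  exact ⟨j, hj, h0, h1⟩

theorem card_of_mem_joins {k : ℕ} {l t : Multiset ℕ} (h : t ∈ joins k l) : t.card = l.card := by
  obtain ⟨j, hj, -, rfl⟩ := mem_joins h
  rw [Multiset.card_cons, Multiset.card_erase_add_one hj]

theorem sum_of_mem_joins {k : ℕ} {l t : Multiset ℕ} (h : t ∈ joins k l) :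
    t.sum = l.sum + k := by
  obtain ⟨j, hj, -, rfl⟩ := mem_joins h
  have := congrArg Multiset.sum (Multiset.cons_erase hj)
  rw [Multiset.sum_cons] at this ⊢
  omega

theorem zero_notMem_of_mem_joins {k : ℕ} {l t : Multiset ℕ} (h : t ∈ joins k l)
    (hl : 0 ∉ l) : 0 ∉ t := by
  obtain ⟨j, hj, h0, rfl⟩ := mem_joins h
  rw [Multiset.mem_cons, not_or]
  exact ⟨by omega, fun h => hl (Multiset.mem_of_mem_erase h)⟩

theorem mem_cuts {m : ℕ} {l t : Multiset ℕ} (h : t ∈ cuts m l) :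
    ∃ s < m, t = (s + 1) ::ₘ (m - s) ::ₘ l := by
  obtain ⟨s, hs, rfl⟩ := Multiset.mem_map.1 h
  exact ⟨s, Multiset.mem_range.1 hs, rfl⟩

theorem card_of_mem_cuts {m : ℕ} {l t : Multiset ℕ} (h : t ∈ cuts m l) :
    t.card = l.card + 2 := by
  obtain ⟨s, -, rfl⟩ := mem_cuts h
  simp

theorem sum_of_mem_cuts {m : ℕ} {l t : Multiset ℕ} (h : t ∈ cuts m l) :
    t.sum = m + 1 + l.sum := by
  obtain ⟨s, hs, rfl⟩ := mem_cuts h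
  simp only [Multiset.sum_cons]
  omega

theorem zero_notMem_of_mem_cuts {m : ℕ} {l t : Multiset ℕ} (h : t ∈ cuts m l)
    (hl : 0 ∉ l) : 0 ∉ t := by
  obtain ⟨s, hs, rfl⟩ := mem_cuts h
  simp only [Multiset.mem_cons, not_or]
  exact ⟨by omega, by omega, hl⟩

/-! ### Power sums, the Vandermonde product and the divergence identity -/

section Polynomials

open MvPolynomial

/-- The product of the power sum polynomials indexed by the parts of `s`. -/
noncomputable def psumProd (N : ℕ) (s : Multiset ℕ) : MvPolynomial (Fin N) ℝ :=
  (s.map (psum (Fin N) ℝ)).prod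

/-- The Vandermonde product `∏_{i<j} (X_i - X_j)`. -/
noncomputable def vandermondeProd (N : ℕ) : MvPolynomial (Fin N) ℝ :=
  ∏ i, ∏ j ∈ Finset.Ioi i, (X i - X j)

/-- The derivation `∑ X_i^r ∂_i`. -/
noncomputable def powerDerivation (N r : ℕ) :
    Derivation ℝ (MvPolynomial (Fin N) ℝ) (MvPolynomial (Fin N) ℝ) :=
  mkDerivation ℝ fun i => X i ^ r

variable {N : ℕ}

theorem psumProd_cons (k : ℕ) (s : Multiset ℕ) :
    psumProd N (k ::ₘ s) = psum (Fin N) ℝ k * psumProd N s := by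
  simp [psumProd]

theorem powerDerivation_apply (r : ℕ) (P : MvPolynomial (Fin N) ℝ) :
    powerDerivation N r P = ∑ i, X i ^ r * pderiv i P := by
  induction P using MvPolynomial.induction_on with
  | C a => simp [powerDerivation]
  | add p q hp hq => simp [hp, hq, mul_add, Finset.sum_add_distrib]
  | mul_X p j hp =>
    rw [Derivation.leibniz, hp]
    simp only [Derivation.leibniz, pderiv_X, smul_eq_mul, mul_add, Finset.sum_add_distrib]
    congr 1
    · simp [powerDerivation, Pi.single_apply, mul_comm]
    · rw [Finset.mul_sum]
      exact Finset.sum_congr rfl fun i _ => by ring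

theorem sum_pderiv_X_pow_mul (r : ℕ) (P : MvPolynomial (Fin N) ℝ) :
    ∑ i, pderiv i (X i ^ r * P) =
      (r : MvPolynomial (Fin N) ℝ) * psum (Fin N) ℝ (r - 1) * P + powerDerivation N r P := by
  simp only [powerDerivation_apply, Derivation.leibniz, Derivation.leibniz_pow, pderiv_X_self,
    smul_eq_mul, Finset.sum_add_distrib, psum, Finset.mul_sum, Finset.sum_mul, nsmul_eq_mul]
  rw [add_comm]
  congr 1
  exact Finset.sum_congr rfl fun i _ => by ring

theorem powerDerivation_psum (k j : ℕ) :
    powerDerivation N (k + 1) (psum (Fin N) ℝ j) =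
      (j : MvPolynomial (Fin N) ℝ) * psum (Fin N) ℝ (j + k) := by
  simp only [psum, map_sum, Derivation.leibniz_pow, powerDerivation, mkDerivation_X, smul_eq_mul,
    nsmul_eq_mul, Finset.mul_sum]
  refine Finset.sum_congr rfl fun i _ => ?_
  rcases j with _ | j
  · simp
  · rw [← pow_add]
    congr 2
    omega

/-- By the Leibniz rule each part j is replaced in turn by j + k with coefficient j, which is why
`joins` counts with multiplicity j. -/
theorem powerDerivation_psumProd (k : ℕ) (s : Multiset ℕ) :
    powerDerivation N (k + 1) (psumProd N s) = ((joins k s).map (psumProd N)).sum := by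
  induction s using Multiset.induction with
  | empty => simp [psumProd, joins_zero]
  | cons a s ih =>
    rw [psumProd_cons, Derivation.leibniz, ih, powerDerivation_psum, joins_cons]
    simp only [smul_eq_mul, Multiset.map_add, Multiset.map_replicate, Multiset.map_map,
      Multiset.sum_add, Function.comp_def, psumProd_cons, Multiset.sum_replicate, nsmul_eq_mul,
      Multiset.sum_map_mul_left]
    ring

/-- Logarithmic differentiation without division. -/
theorem Derivation.prod_eq_prod_mul_sum {R A ι : Type*} [CommRing R] [CommRing A] [Algebra R A]
    (D : Derivation R A A) (s : Finset ι) (f g : ι → A) (h : ∀ i ∈ s, D (f i) = f i * g i) :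
    D (∏ i ∈ s, f i) = (∏ i ∈ s, f i) * ∑ i ∈ s, g i := by
  classical
  induction s using Finset.induction_on with
  | empty => simp
  | insert a s ha ih =>
    rw [Finset.prod_insert ha, Finset.sum_insert ha, Derivation.leibniz,
      ih fun i hi => h i (Finset.mem_insert_of_mem hi), h a (Finset.mem_insert_self _ _),
      smul_eq_mul, smul_eq_mul]
    ring

/-- The quotient (X_i^r - X_j^r) / (X_i - X_j) is a geometric sum, so the logarithmic derivative is
a polynomial. -/
theorem powerDerivation_vandermondeProd (r : ℕ) :
    powerDerivation N r (vandermondeProd N) = vandermondeProd N *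
      ∑ i, ∑ j ∈ Finset.Ioi i, ∑ s ∈ Finset.range r,
        (X i ^ s * X j ^ (r - 1 - s) : MvPolynomial (Fin N) ℝ) := by
  refine Derivation.prod_eq_prod_mul_sum _ _ _ _ fun i _ => ?_
  refine Derivation.prod_eq_prod_mul_sum _ _ _ _ fun j _ => ?_
  rw [mul_comm (X i - X j), (Commute.all (X i) (X j)).geom_sum₂_mul, map_sub]
  simp [powerDerivation]

theorem Fin.two_mul_sum_Ioi {A : Type*} [CommRing A] (f : Fin N → Fin N → A)
    (hf : ∀ i j, f i j = f j i) :
    2 * ∑ i, ∑ j ∈ Finset.Ioi i, f i j = (∑ i, ∑ j, f i j) - ∑ i, f i i := by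
  have h1 : ∀ i, ∑ j, f i j =
      ∑ j ∈ Finset.Ioi i, f i j + ∑ j ∈ Finset.Iio i, f i j + f i i := fun i => by
    rw [← Finset.sum_filter_add_sum_filter_not Finset.univ (fun j => i < j), add_assoc]
    congr 1
    · exact Finset.sum_congr (by ext; simp) fun _ _ => rfl
    · rw [add_comm, ← Finset.sum_insert (by simp)]
      refine Finset.sum_congr ?_ fun _ _ => rfl
      ext j
      simp [le_iff_lt_or_eq, or_comm]
  have h2 : ∑ i, ∑ j ∈ Finset.Iio i, f i j = ∑ i, ∑ j ∈ Finset.Ioi i, f i j := by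
    rw [Finset.sum_comm' (s' := fun j => Finset.Ioi j) (t' := Finset.univ) (by simp)]
    exact Finset.sum_congr rfl fun i _ => Finset.sum_congr rfl fun j _ => hf _ _
  simp only [h1, Finset.sum_add_distrib, h2]
  ring

theorem two_mul_sum_pairs (r : ℕ) :
    2 * ∑ i, ∑ j ∈ Finset.Ioi i, ∑ s ∈ Finset.range r,
        (X i ^ s * X j ^ (r - 1 - s) : MvPolynomial (Fin N) ℝ) =
      ∑ s ∈ Finset.range r, psum (Fin N) ℝ s * psum (Fin N) ℝ (r - 1 - s) -
        (r : MvPolynomial (Fin N) ℝ) * psum (Fin N) ℝ (r - 1) := by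
  rw [Fin.two_mul_sum_Ioi]
  · congr 1
    · simp only [psum, Finset.sum_mul_sum]
      rw [Finset.sum_comm' (s' := fun _ => Finset.univ) (t' := Finset.univ) (by simp),
        Finset.sum_comm]
      simp_rw [Finset.sum_comm (s := Finset.range r)]
    · rw [psum, Finset.mul_sum]
      refine Finset.sum_congr rfl fun i _ => ?_
      rw [Finset.sum_congr rfl (g := fun _ => X i ^ (r - 1)), Finset.sum_const,
        Finset.card_range, nsmul_eq_mul]
      intro s hs
      rw [← pow_add]
      congr 1
      have := Finset.mem_range.1 hs
      omega
  · intro i j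
    rw [← Finset.sum_range_reflect]
    refine Finset.sum_congr rfl fun s hs => ?_
    have := Finset.mem_range.1 hs
    rw [mul_comm]
    congr 2
    omega

/-- The exponent 2 doubles the sum over pairs, making it a full double sum minus its diagonal r
p_(r-1). That diagonal cancels exactly the term from differentiating X_i^r. -/
theorem sum_pderiv_X_pow_mul_sq (r : ℕ) (f : MvPolynomial (Fin N) ℝ) :
    ∑ i, pderiv i (X i ^ r * (f * vandermondeProd N ^ 2)) =
      (powerDerivation N r f + f * ∑ s ∈ Finset.range r,
        psum (Fin N) ℝ s * psum (Fin N) ℝ (r - 1 - s)) * vandermondeProd N ^ 2 := by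
  rw [sum_pderiv_X_pow_mul, Derivation.leibniz, Derivation.leibniz_pow,
    powerDerivation_vandermondeProd]
  simp only [smul_eq_mul, nsmul_eq_mul]
  push_cast
  linear_combination (f * vandermondeProd N ^ 2) * two_mul_sum_pairs (N := N) r

/-- The divergence `∂_i (X_i (1 - X_i) P w) / w` for the weight
`w = ∏ X_i^{a-1} (1-X_i)^{b-1}`. -/
noncomputable def weightedDivergence (a b : ℝ) (i : Fin N) (P : MvPolynomial (Fin N) ℝ) :
    MvPolynomial (Fin N) ℝ :=
  pderiv i (X i * P) - pderiv i (X i ^ 2 * P) + C (a - 1) * P - C (a + b - 2) * (X i * P)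

theorem sum_weightedDivergence (a b : ℝ) (m : ℕ) (f : MvPolynomial (Fin N) ℝ) :
    ∑ i, weightedDivergence a b i (X i ^ m * (f * vandermondeProd N ^ 2)) =
      (powerDerivation N (m + 1) f + f * ∑ s ∈ Finset.range (m + 1),
          psum (Fin N) ℝ s * psum (Fin N) ℝ (m - s)
        - (powerDerivation N (m + 2) f + f * ∑ s ∈ Finset.range (m + 2),
          psum (Fin N) ℝ s * psum (Fin N) ℝ (m + 1 - s))
        + C (a - 1) * (psum (Fin N) ℝ m * f) - C (a + b - 2) * (psum (Fin N) ℝ (m + 1) * f)) *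
        vandermondeProd N ^ 2 := by
  have h1 := sum_pderiv_X_pow_mul_sq (N := N) (m + 1) f
  have h2 := sum_pderiv_X_pow_mul_sq (N := N) (m + 2) f
  rw [show m + 1 - 1 = m by omega] at h1
  rw [show m + 2 - 1 = m + 1 by omega] at h2
  simp only [weightedDivergence, Finset.sum_add_distrib, Finset.sum_sub_distrib]
  simp only [← mul_assoc, ← pow_succ', ← pow_add]
  simp only [mul_assoc, show 2 + m = m + 2 by omega] at h1 h2 ⊢
  rw [h1, h2]
  simp only [psum, ← Finset.mul_sum, ← Finset.sum_mul]
  ring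

end Polynomials

/-! ### Integrals over the cube and the loop equations -/

section Integrals

open MeasureTheory MvPolynomial

variable {N : ℕ} {a b : ℝ}

theorem integrableOn_beta (ha : 0 < a) (hb : 0 < b) :
    IntegrableOn (fun x : ℝ => x ^ (a - 1) * (1 - x) ^ (b - 1)) (Set.Icc 0 1) := by
  have h := Complex.betaIntegral_convergent (u := a) (v := b) (by simpa) (by simpa)
  rw [intervalIntegrable_iff_integrableOn_Ioc_of_le zero_le_one] at h
  rw [integrableOn_Icc_iff_integrableOn_Ioc]
  refine (IntegrableOn.congr_fun h.re (fun x hx => ?_) measurableSet_Ioc)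
  have h1 : (0 : ℝ) ≤ 1 - x := by linarith [hx.2]
  simp only [RCLike.re_to_complex]
  rw [← Complex.ofReal_one, ← Complex.ofReal_sub, ← Complex.ofReal_sub, ← Complex.ofReal_sub,
    ← Complex.ofReal_cpow hx.1.le, ← Complex.ofReal_cpow h1, ← Complex.ofReal_mul,
    Complex.ofReal_re]

theorem integral_beta (ha : 0 < a) (hb : 0 < b) :
    ∫ x in Set.Icc (0 : ℝ) 1, x ^ (a - 1) * (1 - x) ^ (b - 1) = ProbabilityTheory.beta a b := by
  rw [ProbabilityTheory.beta_eq_betaIntegralReal a b ha hb, Complex.betaIntegral,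
    intervalIntegral.integral_of_le zero_le_one, integral_Icc_eq_integral_Ioc,
    ← RCLike.re_to_complex, ← integral_re]
  · refine setIntegral_congr_fun measurableSet_Ioc fun x hx => ?_
    have h1 : (0 : ℝ) ≤ 1 - x := by linarith [hx.2]
    simp only [RCLike.re_to_complex]
    rw [← Complex.ofReal_one, ← Complex.ofReal_sub, ← Complex.ofReal_sub, ← Complex.ofReal_sub,
      ← Complex.ofReal_cpow hx.1.le, ← Complex.ofReal_cpow h1, ← Complex.ofReal_mul,
      Complex.ofReal_re]
  · have h := Complex.betaIntegral_convergent (u := a) (v := b) (by simpa) (by simpa)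
    rwa [intervalIntegrable_iff_integrableOn_Ioc_of_le zero_le_one] at h

theorem pow_mul_rpow_ae_eq (a b : ℝ) (e : ℕ) :
    (fun x : ℝ => x ^ e * (x ^ (a - 1) * (1 - x) ^ (b - 1)))
      =ᵐ[volume.restrict (Set.Icc 0 1)] fun x => x ^ (a + e - 1) * (1 - x) ^ (b - 1) := by
  rw [← restrict_Ioc_eq_restrict_Icc, EventuallyEq, ae_restrict_iff' measurableSet_Ioc]
  refine Eventually.of_forall fun x hx => ?_
  rw [← mul_assoc, ← Real.rpow_natCast, ← Real.rpow_add hx.1]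
  congr 2
  ring

/-- The one-variable integration by parts, read off from the Gamma function; every vanishing
divergence reduces to it. -/
theorem beta_add_one (ha : 0 < a) (hb : 0 < b) :
    (a + b) * ProbabilityTheory.beta (a + 1) b = a * ProbabilityTheory.beta a b := by
  unfold ProbabilityTheory.beta
  rw [show a + 1 + b = a + b + 1 by ring, Real.Gamma_add_one ha.ne',
    Real.Gamma_add_one (add_pos ha hb).ne']
  have h1 := (Real.Gamma_pos_of_pos (add_pos ha hb)).ne'
  have h2 := (add_pos ha hb).ne'
  field_simp

/-- The integral of a polynomial against `∏ x_i^{a-1} (1-x_i)^{b-1}` on the unit cube. -/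
noncomputable def cubeIntegral (a b : ℝ) (P : MvPolynomial (Fin N) ℝ) : ℝ :=
  ∫ x in Set.Icc (0 : Fin N → ℝ) 1, eval x P * ∏ i, (x i ^ (a - 1) * (1 - x i) ^ (b - 1))

theorem restrict_cube :
    (volume : Measure (Fin N → ℝ)).restrict (Set.Icc 0 1) =
      Measure.pi fun _ => (volume : Measure ℝ).restrict (Set.Icc 0 1) := by
  rw [← Set.pi_univ_Icc, volume_pi, Measure.restrict_pi_pi]
  rfl

theorem eval_monomial_mul_prod (e : Fin N →₀ ℕ) (c : ℝ) (w : ℝ → ℝ) (x : Fin N → ℝ) :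
    eval x (monomial e c) * ∏ i, w (x i) = c * ∏ i, (x i ^ e i * w (x i)) := by
  rw [eval_monomial, Finsupp.prod_fintype _ _ (by simp), Finset.prod_mul_distrib, mul_assoc]

theorem integrableOn_cube (ha : 0 < a) (hb : 0 < b) (P : MvPolynomial (Fin N) ℝ) :
    IntegrableOn (fun x => eval x P * ∏ i, (x i ^ (a - 1) * (1 - x i) ^ (b - 1)))
      (Set.Icc (0 : Fin N → ℝ) 1) := by
  induction P using MvPolynomial.induction_on' with
  | monomial e c =>
    simp_rw [eval_monomial_mul_prod e c fun y => y ^ (a - 1) * (1 - y) ^ (b - 1)]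
    refine Integrable.const_mul ?_ c
    rw [restrict_cube]
    refine Integrable.fintype_prod_dep
      (f := fun i y => y ^ e i * (y ^ (a - 1) * (1 - y) ^ (b - 1))) fun i => ?_
    exact (integrable_congr (pow_mul_rpow_ae_eq a b (e i))).2
      (integrableOn_beta (by positivity) hb)
  | add P Q hP hQ =>
    simp only [map_add, add_mul]
    exact hP.add hQ

theorem cubeIntegral_monomial (ha : 0 < a) (hb : 0 < b) (e : Fin N →₀ ℕ) (c : ℝ) :
    cubeIntegral a b (monomial e c) = c * ∏ i, ProbabilityTheory.beta (a + e i) b := by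
  unfold cubeIntegral
  simp_rw [eval_monomial_mul_prod e c fun y => y ^ (a - 1) * (1 - y) ^ (b - 1)]
  rw [integral_const_mul, restrict_cube, integral_fintype_prod_eq_prod
    fun i y => y ^ e i * (y ^ (a - 1) * (1 - y) ^ (b - 1))]
  congr 1
  refine Finset.prod_congr rfl fun i _ => ?_
  rw [integral_congr_ae (pow_mul_rpow_ae_eq a b (e i)), integral_beta (by positivity) hb]

theorem cubeIntegral_add (ha : 0 < a) (hb : 0 < b) (P Q : MvPolynomial (Fin N) ℝ) :
    cubeIntegral a b (P + Q) = cubeIntegral a b P + cubeIntegral a b Q := by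
  unfold cubeIntegral
  rw [← integral_add (integrableOn_cube ha hb P) (integrableOn_cube ha hb Q)]
  simp only [map_add, add_mul]

theorem cubeIntegral_C_mul (c : ℝ) (P : MvPolynomial (Fin N) ℝ) :
    cubeIntegral a b (C c * P) = c * cubeIntegral a b P := by
  unfold cubeIntegral
  rw [← integral_const_mul]
  simp only [map_mul, eval_C, mul_assoc]

/-- `cubeIntegral` as a linear map. -/
noncomputable def cubeIntegralₗ (ha : 0 < a) (hb : 0 < b) : MvPolynomial (Fin N) ℝ →ₗ[ℝ] ℝ where
  toFun := cubeIntegral a b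
  map_add' := cubeIntegral_add ha hb
  map_smul' c P := by rw [smul_eq_C_mul, cubeIntegral_C_mul]; rfl

theorem weightedDivergence_monomial (i : Fin N) (e : Fin N →₀ ℕ) (c : ℝ) :
    weightedDivergence a b i (monomial e c) =
      monomial e ((a + e i) * c) - monomial (e + Finsupp.single i 1) ((a + b + e i) * c) := by
  have h1 : (X i * monomial e c : MvPolynomial (Fin N) ℝ) =
      monomial (e + Finsupp.single i 1) c := by
    rw [X, monomial_mul, one_mul, add_comm]
  have h2 : (X i ^ 2 * monomial e c : MvPolynomial (Fin N) ℝ) =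
      monomial (e + Finsupp.single i 1 + Finsupp.single i 1) c := by
    rw [pow_two, mul_assoc, h1, X, monomial_mul, one_mul, add_comm]
  rw [weightedDivergence, h1, h2, pderiv_monomial, pderiv_monomial, C_mul_monomial,
    C_mul_monomial, add_tsub_cancel_right, add_tsub_cancel_right]
  simp only [Finsupp.add_apply, Finsupp.single_eq_same]
  rw [sub_add_eq_add_sub, ← map_add, sub_sub, ← map_add]
  congr 2 <;> push_cast <;> ring

/-- On monomials the integral is a product of Beta values, and only the i-th factor changes. No
boundary terms have to be estimated, even where the weight is singular. -/
theorem cubeIntegral_weightedDivergence (ha : 0 < a) (hb : 0 < b) (i : Fin N)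
    (P : MvPolynomial (Fin N) ℝ) : cubeIntegral a b (weightedDivergence a b i P) = 0 := by
  induction P using MvPolynomial.induction_on' with
  | monomial e c =>
    rw [weightedDivergence_monomial]
    change cubeIntegralₗ ha hb _ = 0
    rw [map_sub]
    change cubeIntegral a b _ - cubeIntegral a b _ = 0
    rw [cubeIntegral_monomial ha hb, cubeIntegral_monomial ha hb,
      ← Finset.mul_prod_erase _ _ (Finset.mem_univ i),
      ← Finset.mul_prod_erase _ _ (Finset.mem_univ i)]
    have h1 : ∏ j ∈ Finset.univ.erase i,
        ProbabilityTheory.beta (a + ((e + Finsupp.single i 1 : Fin N →₀ ℕ) j : ℕ)) b =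
        ∏ j ∈ Finset.univ.erase i, ProbabilityTheory.beta (a + (e j : ℕ)) b := by
      refine Finset.prod_congr rfl fun j hj => ?_
      rw [Finsupp.add_apply, Finsupp.single_eq_of_ne (Finset.ne_of_mem_erase hj), add_zero]
    have h2 := beta_add_one (a := a + e i) (by positivity) hb
    rw [h1, Finsupp.add_apply, Finsupp.single_eq_same, Nat.cast_add, Nat.cast_one, ← add_assoc]
    linear_combination (-c * ∏ j ∈ Finset.univ.erase i,
      ProbabilityTheory.beta (a + (e j : ℕ)) b) * h2
  | add P Q hP hQ =>
    have : weightedDivergence a b i (P + Q) =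
        weightedDivergence a b i P + weightedDivergence a b i Q := by
      simp only [weightedDivergence, mul_add, map_add]
      ring
    rw [this, cubeIntegral_add ha hb, hP, hQ, add_zero]

/-- The integrand is nonnegative, and nonzero on the nonempty open set of interior points with
distinct coordinates. -/
theorem cubeIntegral_vandermondeProd_sq_pos (ha : 0 < a) (hb : 0 < b) :
    0 < cubeIntegral a b (vandermondeProd N ^ 2) := by
  unfold cubeIntegral
  have hw : ∀ x ∈ Set.Icc (0 : Fin N → ℝ) 1, 0 ≤ eval x (vandermondeProd N ^ 2) *
      ∏ i, (x i ^ (a - 1) * (1 - x i) ^ (b - 1)) := fun x hx => by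
    rw [map_pow]
    refine mul_nonneg (sq_nonneg _) (Finset.prod_nonneg fun i _ => ?_)
    exact mul_nonneg (Real.rpow_nonneg (hx.1 i) _) (Real.rpow_nonneg (sub_nonneg.2 (hx.2 i)) _)
  rw [setIntegral_pos_iff_support_of_nonneg_ae
    ((ae_restrict_iff' measurableSet_Icc).2 (Eventually.of_forall hw))
    (integrableOn_cube ha hb _)]
  let U : Set (Fin N → ℝ) := {x | (∀ i, 0 < x i ∧ x i < 1) ∧ ∀ i j, i < j → x i ≠ x j}
  have hU : IsOpen U := by
    refine IsOpen.inter (s := {x : Fin N → ℝ | ∀ i, 0 < x i ∧ x i < 1})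
      (t := {x : Fin N → ℝ | ∀ i j, i < j → x i ≠ x j}) ?_ ?_
    · simp only [Set.ofPred_forall, Set.ofPred_and]
      exact isOpen_iInter_of_finite fun i =>
        (isOpen_lt continuous_const (continuous_apply i)).inter
          (isOpen_lt (continuous_apply i) continuous_const)
    · simp only [Set.ofPred_forall]
      exact isOpen_iInter_of_finite fun i => isOpen_iInter_of_finite fun j =>
        isOpen_iInter_of_finite fun _ => isOpen_ne_fun (continuous_apply i) (continuous_apply j)
  have hne : U.Nonempty := by
    refine ⟨fun i => ((i : ℕ) + 1 : ℝ) / (N + 1), fun i => ⟨by positivity, ?_⟩, fun i j hij => ?_⟩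
    · rw [div_lt_one (by positivity)]
      exact_mod_cast Nat.succ_lt_succ i.2
    · refine (div_lt_div_of_pos_right ?_ (by positivity)).ne
      exact_mod_cast Nat.succ_lt_succ hij
  refine (hU.measure_pos volume hne).trans_le (measure_mono ?_)
  intro x hx
  refine ⟨?_, fun i => (hx.1 i).1.le, fun i => (hx.1 i).2.le⟩
  rw [Function.mem_support]
  refine mul_ne_zero ?_ (Finset.prod_ne_zero_iff.2 fun i _ => ?_)
  · simp only [vandermondeProd, map_pow, map_prod, map_sub, eval_X]
    refine pow_ne_zero _ (Finset.prod_ne_zero_iff.2 fun i _ =>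
      Finset.prod_ne_zero_iff.2 fun j hj => sub_ne_zero.2 (hx.2 i j (Finset.mem_Ioi.1 hj)))
  · exact mul_ne_zero (Real.rpow_pos_of_pos (hx.1 i).1 _).ne'
      (Real.rpow_pos_of_pos (sub_pos.2 (hx.1 i).2) _).ne'

/-- The normalised average of `∏_{k ∈ s} p_k`. -/
noncomputable def jacobiMoment (N : ℕ) (s : Multiset ℕ) (a b : ℝ) : ℝ :=
  cubeIntegral a b (psumProd N s * vandermondeProd N ^ 2) /
    cubeIntegral a b (vandermondeProd N ^ 2)

theorem jacobiAverage_eval (P : MvPolynomial (Fin N) ℝ) :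
    jacobiAverage N a b (fun x => eval x P) =
      1 / (N.factorial : ℝ) * cubeIntegral a b (P * vandermondeProd N ^ 2) := by
  unfold jacobiAverage cubeIntegral
  simp only [vandermondeProd, map_mul, map_pow, map_prod, map_sub, eval_X, Finset.prod_pow]

theorem selbergRatio_eq_jacobiMoment (k : ℕ) :
    selbergRatio N k a b = jacobiMoment N {k} a b := by
  have h1 : powerSum N k = fun x => eval x (psumProd N {k}) := by
    ext x
    simp [psumProd, psum, powerSum]
  have h2 : (fun _ => 1 : (Fin N → ℝ) → ℝ) = fun x => eval x 1 := by simp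
  rw [selbergRatio, h1, h2, jacobiAverage_eval, jacobiAverage_eval, one_mul, jacobiMoment,
    mul_div_mul_left]
  positivity

theorem jacobiMoment_zero (ha : 0 < a) (hb : 0 < b) : jacobiMoment N 0 a b = 1 := by
  simp [jacobiMoment, psumProd, (cubeIntegral_vandermondeProd_sq_pos ha hb).ne']

theorem jacobiMoment_zero_cons (s : Multiset ℕ) :
    jacobiMoment N (0 ::ₘ s) a b = N * jacobiMoment N s a b := by
  rw [jacobiMoment, psumProd_cons, psum_zero, Fintype.card_fin, mul_assoc,
    show (N : MvPolynomial (Fin N) ℝ) = C (N : ℝ) by simp, cubeIntegral_C_mul, mul_div_assoc]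
  rfl

/-- The loop equations of the Jacobi ensemble. -/
theorem jacobiMoment_loop (ha : 0 < a) (hb : 0 < b) (m : ℕ) (l : Multiset ℕ) :
    (a + b - 2 + 2 * N) * jacobiMoment N ((m + 1) ::ₘ l) a b +
        ((cuts m l).map fun t => jacobiMoment N t a b).sum +
        ((joins (m + 1) l).map fun t => jacobiMoment N t a b).sum =
      (a - 1) * jacobiMoment N (m ::ₘ l) a b +
        ((Multiset.range (m + 1)).map fun s => jacobiMoment N (s ::ₘ (m - s) ::ₘ l) a b).sum +
        ((joins m l).map fun t => jacobiMoment N t a b).sum := by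
  let φ : MvPolynomial (Fin N) ℝ →ₗ[ℝ] ℝ := (cubeIntegral a b (vandermondeProd N ^ 2))⁻¹ •
    cubeIntegralₗ ha hb ∘ₗ LinearMap.mulRight ℝ (vandermondeProd N ^ 2)
  have hφ : ∀ s, jacobiMoment N s a b = φ (psumProd N s) := fun s => by
    rw [jacobiMoment, div_eq_inv_mul]
    rfl
  have hsum : ∀ T : Multiset (Multiset ℕ), (T.map fun t => jacobiMoment N t a b).sum =
      φ (T.map (psumProd N)).sum := fun T => by
    simp only [hφ, map_multiset_sum, Multiset.map_map, Function.comp_def]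
  have key := congrArg (cubeIntegralₗ ha hb) (sum_weightedDivergence a b m (psumProd N l))
  rw [map_sum, Finset.sum_eq_zero (f := fun i => cubeIntegralₗ ha hb _)
    fun i _ => cubeIntegral_weightedDivergence ha hb i _] at key
  have key2 : φ (powerDerivation N (m + 1) (psumProd N l) +
        psumProd N l * ∑ s ∈ Finset.range (m + 1), psum (Fin N) ℝ s * psum (Fin N) ℝ (m - s)
        - (powerDerivation N (m + 2) (psumProd N l) + psumProd N l *
          ∑ s ∈ Finset.range (m + 2), psum (Fin N) ℝ s * psum (Fin N) ℝ (m + 1 - s))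
        + C (a - 1) * (psum (Fin N) ℝ m * psumProd N l)
        - C (a + b - 2) * (psum (Fin N) ℝ (m + 1) * psumProd N l)) = 0 := by
    change (cubeIntegral a b (vandermondeProd N ^ 2))⁻¹ * cubeIntegralₗ ha hb _ = 0
    rw [LinearMap.mulRight_apply, ← key, mul_zero]
  have hr : psumProd N l * ∑ s ∈ Finset.range (m + 1),
      psum (Fin N) ℝ s * psum (Fin N) ℝ (m - s) =
      ((Multiset.range (m + 1)).map fun s => psumProd N (s ::ₘ (m - s) ::ₘ l)).sum := by
    rw [Finset.mul_sum, Finset.sum, Finset.range_val]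
    refine congrArg _ (Multiset.map_congr rfl fun s _ => ?_)
    rw [psumProd_cons, psumProd_cons]
    ring
  -- The two end terms s = 0 and s = m + 1 contain p_0 = N; they are the 2N in the diagonal
  -- coefficient. The rest are the genuine cuts.
  have hc : psumProd N l * ∑ s ∈ Finset.range (m + 2),
      psum (Fin N) ℝ s * psum (Fin N) ℝ (m + 1 - s) =
      ((cuts m l).map (psumProd N)).sum + C (2 * (N : ℝ)) * psumProd N ((m + 1) ::ₘ l) := by
    rw [Finset.sum_range_succ, Finset.sum_range_succ', cuts, Multiset.map_map, mul_add, mul_add,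
      Finset.mul_sum, Finset.sum, Finset.range_val, psumProd_cons, Nat.sub_self, psum_zero,
      Fintype.card_fin, Nat.sub_zero, map_mul, map_natCast, map_ofNat, add_assoc]
    congr 1
    · refine congrArg _ (Multiset.map_congr rfl fun s _ => ?_)
      rw [Function.comp_apply, psumProd_cons, psumProd_cons,
        show m + 1 - (s + 1) = m - s by omega]
      ring
    · ring
  rw [powerDerivation_psumProd, powerDerivation_psumProd, hr, hc, ← psumProd_cons,
    ← psumProd_cons] at key2
  simp only [← smul_eq_C_mul] at key2
  simp only [map_sub, map_add, map_smul, smul_eq_mul] at key2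
  have hrange : ((Multiset.range (m + 1)).map fun s =>
      jacobiMoment N (s ::ₘ (m - s) ::ₘ l) a b).sum = φ ((Multiset.range (m + 1)).map fun s =>
        psumProd N (s ::ₘ (m - s) ::ₘ l)).sum := by
    simp only [hφ, map_multiset_sum, Multiset.map_map, Function.comp_def]
  rw [hsum, hsum, hsum, hrange, hφ, hφ]
  linear_combination -key2

end Integrals

/-! ### Rational continuation in the parameters -/

section Continuation

open MvPolynomial

/-- `c` is the value at `(a, b)` of the rational function that extends `F` beyond the open
positive quadrant. -/
def IsRatCont (F : ℝ → ℝ → ℝ) (a b c : ℝ) : Prop :=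
  ∃ P Q : MvPolynomial (Fin 2) ℝ, eval ![a, b] Q ≠ 0 ∧
    (∀ a' b' : ℝ, 0 < a' → 0 < b' → eval ![a', b'] Q ≠ 0 →
      F a' b' = eval ![a', b'] P / eval ![a', b'] Q) ∧
    c = eval ![a, b] P / eval ![a, b] Q

theorem isContinuedRatio_iff {N k : ℕ} {a b c : ℝ} :
    IsContinuedRatio N k a b c ↔ IsRatCont (jacobiMoment N {k}) a b c := by
  simp only [IsContinuedRatio, IsRatCont, selbergRatio_eq_jacobiMoment]

variable {F G : ℝ → ℝ → ℝ} {a b c d : ℝ}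

theorem MvPolynomial.eq_of_eval_quadrant {P Q : MvPolynomial (Fin 2) ℝ}
    (h : ∀ a b : ℝ, 0 < a → 0 < b → eval ![a, b] P = eval ![a, b] Q) : P = Q := by
  refine funext_set (fun _ => Set.Ioi 0) (fun _ => Set.Ioi_infinite 0) fun x hx => ?_
  have : x = ![x 0, x 1] := by
    ext i
    fin_cases i <;> rfl
  rw [this]
  exact h _ _ (hx 0 trivial) (hx 1 trivial)

theorem IsRatCont.congr (h : IsRatCont F a b c)
    (hFG : ∀ a' b', 0 < a' → 0 < b' → F a' b' = G a' b') : IsRatCont G a b c := by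
  obtain ⟨P, Q, hQ, h1, h2⟩ := h
  exact ⟨P, Q, hQ, fun a' b' ha hb hQ' => by rw [← hFG a' b' ha hb, h1 a' b' ha hb hQ'], h2⟩

theorem IsRatCont.unique (h : IsRatCont F a b c) (h' : IsRatCont F a b d) : c = d := by
  obtain ⟨P, Q, hQ, h1, rfl⟩ := h
  obtain ⟨P', Q', hQ', h1', rfl⟩ := h'
  -- The extra factor Q * Q' makes the identity trivial where a denominator vanishes, so it can be
  -- tested on the whole quadrant.
  have key : P * Q' * (Q * Q') = P' * Q * (Q * Q') := by
    refine MvPolynomial.eq_of_eval_quadrant fun x y hx hy => ?_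
    simp only [map_mul]
    by_cases hq : eval ![x, y] Q = 0
    · simp [hq]
    by_cases hq' : eval ![x, y] Q' = 0
    · simp [hq']
    have := (h1 x y hx hy hq).symm.trans (h1' x y hx hy hq')
    rw [div_eq_div_iff hq hq'] at this
    rw [this]
  have := congrArg (eval ![a, b]) key
  simp only [map_mul] at this
  rw [div_eq_div_iff hQ hQ']
  exact mul_right_cancel₀ (mul_ne_zero hQ hQ') this

theorem isRatCont_eval (P : MvPolynomial (Fin 2) ℝ) (a b : ℝ) :
    IsRatCont (fun x y => eval ![x, y] P) a b (eval ![a, b] P) :=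
  ⟨P, 1, by simp, by simp, by simp⟩

theorem isRatCont_const (r a b : ℝ) : IsRatCont (fun _ _ => r) a b r := by
  simpa using isRatCont_eval (C r) a b

theorem isRatCont_fst (a b : ℝ) : IsRatCont (fun x _ => x) a b a := by
  simpa using isRatCont_eval (X 0) a b

theorem isRatCont_snd (a b : ℝ) : IsRatCont (fun _ y => y) a b b := by
  simpa using isRatCont_eval (X 1) a b

theorem IsRatCont.add (h : IsRatCont F a b c) (h' : IsRatCont G a b d) :
    IsRatCont (fun x y => F x y + G x y) a b (c + d) := by
  obtain ⟨P, Q, hQ, h1, rfl⟩ := h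
  obtain ⟨P', Q', hQ', h1', rfl⟩ := h'
  refine ⟨P * Q' + Q * P', Q * Q', by simp [hQ, hQ'], fun x y hx hy hq => ?_, ?_⟩
  · rw [map_mul] at hq
    change F x y + G x y = _
    rw [h1 x y hx hy (left_ne_zero_of_mul hq), h1' x y hx hy (right_ne_zero_of_mul hq),
      div_add_div _ _ (left_ne_zero_of_mul hq) (right_ne_zero_of_mul hq)]
    simp
  · rw [div_add_div _ _ hQ hQ']
    simp

theorem IsRatCont.mul (h : IsRatCont F a b c) (h' : IsRatCont G a b d) :
    IsRatCont (fun x y => F x y * G x y) a b (c * d) := by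
  obtain ⟨P, Q, hQ, h1, rfl⟩ := h
  obtain ⟨P', Q', hQ', h1', rfl⟩ := h'
  refine ⟨P * P', Q * Q', by simp [hQ, hQ'], fun x y hx hy hq => ?_, ?_⟩
  · rw [map_mul] at hq
    change F x y * G x y = _
    rw [h1 x y hx hy (left_ne_zero_of_mul hq), h1' x y hx hy (right_ne_zero_of_mul hq),
      div_mul_div_comm]
    simp
  · rw [div_mul_div_comm]
    simp

theorem IsRatCont.sub_const (h : IsRatCont F a b c) (r : ℝ) :
    IsRatCont (fun x y => F x y - r) a b (c - r) :=
  h.add (isRatCont_const (-r) a b)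

theorem IsRatCont.of_eval_mul {Q : MvPolynomial (Fin 2) ℝ} (hQ : eval ![a, b] Q ≠ 0)
    (h : IsRatCont (fun x y => eval ![x, y] Q * F x y) a b c) : ∃ d, IsRatCont F a b d := by
  obtain ⟨P, R, hR, h1, -⟩ := h
  refine ⟨_, P, R * Q, by simp [hR, hQ], fun x y hx hy hq => ?_, rfl⟩
  rw [map_mul] at hq
  have := h1 x y hx hy (left_ne_zero_of_mul hq)
  rw [map_mul, ← div_div, ← this, mul_div_cancel_left₀ _ (right_ne_zero_of_mul hq)]

theorem isRatCont_multiset_sum {α : Type*} {T : Multiset α} {f : α → ℝ → ℝ → ℝ} {w : α → ℝ}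
    (h : ∀ t ∈ T, IsRatCont (f t) a b (w t)) :
    IsRatCont (fun x y => (T.map fun t => f t x y).sum) a b (T.map w).sum := by
  induction T using Multiset.induction with
  | empty => simpa using isRatCont_const 0 a b
  | cons t T ih =>
    simp only [Multiset.map_cons, Multiset.sum_cons]
    exact (h t (Multiset.mem_cons_self t T)).add
      (ih fun t' ht' => h t' (Multiset.mem_cons_of_mem ht'))

theorem exists_isRatCont_finset_sum {α : Type*} {T : Finset α} {f : α → ℝ → ℝ → ℝ}
    (h : ∀ t ∈ T, ∃ w, IsRatCont (f t) a b w) :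
    ∃ w, IsRatCont (fun x y => ∑ t ∈ T, f t x y) a b w := by
  choose! w hw using h
  exact ⟨_, isRatCont_multiset_sum hw⟩

/-- Cramer's rule: the solution of a linear system whose matrix is polynomial in the parameters
continues rationally to the points where that matrix is invertible. -/
theorem exists_isRatCont_of_mulVec {ι : Type*} [Fintype ι] [DecidableEq ι]
    (M : Matrix ι ι (MvPolynomial (Fin 2) ℝ)) (e r : ι → ℝ → ℝ → ℝ)
    (hdet : (M.map (eval ![a, b])).det ≠ 0)
    (he : ∀ x y, 0 < x → 0 < y → ∀ i,
      ((M.map (eval ![x, y])).mulVec fun j => e j x y) i = r i x y)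
    (hr : ∀ i, ∃ w, IsRatCont (r i) a b w) (i : ι) : ∃ w, IsRatCont (e i) a b w := by
  have hQ : eval ![a, b] M.det ≠ 0 := by
    rwa [RingHom.map_det]
  have hsum : ∃ w, IsRatCont (fun x y => ∑ j, eval ![x, y] (M.adjugate i j) * r j x y) a b w :=
    exists_isRatCont_finset_sum fun j _ => by
      obtain ⟨w, hw⟩ := hr j
      exact ⟨_, (isRatCont_eval _ a b).mul hw⟩
  obtain ⟨w, hw⟩ := hsum
  refine IsRatCont.of_eval_mul hQ (hw.congr fun x y hx hy => ?_)
  have h1 : (fun j => r j x y) = (M.map (eval ![x, y])).mulVec fun j => e j x y :=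
    funext fun j => (he x y hx hy j).symm
  have h2 : ((M.map (eval ![x, y])).adjugate.mulVec fun j => r j x y) i =
      ∑ j, eval ![x, y] (M.adjugate i j) * r j x y := by
    have : (M.map (eval ![x, y])).adjugate = M.adjugate.map (eval ![x, y]) :=
      ((eval ![x, y]).map_adjugate M).symm
    rw [this]
    rfl
  rw [← h2, h1, Matrix.mulVec_mulVec, Matrix.adjugate_mul, Matrix.smul_mulVec, Matrix.one_mulVec,
    RingHom.map_det]
  rfl

end Continuation

/-! ### Continuation of the averages by diagonal dominance -/

theorem Multiset.sum_count_mul_eq_sum_map {α : Type*} [DecidableEq α] {T : Multiset α}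
    {F : Finset α} (h : ∀ t ∈ T, t ∈ F) (f : α → ℝ) :
    ∑ t ∈ F, (T.count t : ℝ) * f t = (T.map f).sum := by
  rw [Finset.sum_multiset_map_count]
  simp only [nsmul_eq_mul]
  refine (Finset.sum_subset (fun t ht => h t (Multiset.mem_toFinset.1 ht)) fun t _ ht => ?_).symm
  rw [Multiset.count_eq_zero.2 fun h' => ht (Multiset.mem_toFinset.2 h'), Nat.cast_zero, zero_mul]

/-- The partitions of `n`, as multisets. -/
def partitionFinset (n : ℕ) : Finset (Multiset ℕ) :=
  Finset.univ.image (Nat.Partition.parts (n := n))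

theorem mem_partitionFinset {n : ℕ} {s : Multiset ℕ} :
    s ∈ partitionFinset n ↔ s.sum = n ∧ 0 ∉ s := by
  simp only [partitionFinset, Finset.mem_image, Finset.mem_univ, true_and]
  constructor
  · rintro ⟨p, rfl⟩
    exact ⟨p.parts_sum, fun h => (p.parts_pos h).ne' rfl⟩
  · rintro ⟨h1, h2⟩
    exact ⟨⟨s, fun {i} hi => Nat.pos_of_ne_zero fun h => h2 (h ▸ hi), h1⟩, rfl⟩

theorem exists_eq_cons_of_mem_partitionFinset {n : ℕ} {s : Multiset ℕ}
    (hs : s ∈ partitionFinset (n + 1)) :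
    ∃ (m : ℕ) (l : Multiset ℕ), s = (m + 1) ::ₘ l ∧ m + l.sum = n ∧ 0 ∉ l := by
  obtain ⟨h1, h2⟩ := mem_partitionFinset.1 hs
  obtain ⟨j, hj⟩ : ∃ j, j ∈ s := Multiset.exists_mem_of_ne_zero fun h => by simp [h] at h1
  obtain ⟨l, rfl⟩ := Multiset.exists_cons_of_mem hj
  rw [Multiset.mem_cons, not_or] at h2
  rw [Multiset.sum_cons] at h1
  refine ⟨j - 1, l, ?_, by omega, h2.2⟩
  rw [Nat.sub_add_cancel (by omega)]

theorem mem_partitionFinset_of_mem_cuts {n m : ℕ} {l t : Multiset ℕ} (hn : m + l.sum = n)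
    (hl : 0 ∉ l) (h : t ∈ cuts m l) : t ∈ partitionFinset (n + 1) :=
  mem_partitionFinset.2 ⟨by rw [sum_of_mem_cuts h]; omega, zero_notMem_of_mem_cuts h hl⟩

theorem mem_partitionFinset_of_mem_joins {n m : ℕ} {l t : Multiset ℕ} (hn : m + l.sum = n)
    (hl : 0 ∉ l) (h : t ∈ joins (m + 1) l) : t ∈ partitionFinset (n + 1) :=
  mem_partitionFinset.2 ⟨by rw [sum_of_mem_joins h]; omega, zero_notMem_of_mem_joins h hl⟩

section

variable {N : ℕ} {a b : ℝ}

theorem jacobiMoment_replicate_zero_add (k : ℕ) (s : Multiset ℕ) :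
    jacobiMoment N (Multiset.replicate k 0 + s) a b = N ^ k * jacobiMoment N s a b := by
  induction k with
  | zero => simp
  | succ k ih =>
    rw [Multiset.replicate_succ, Multiset.cons_add, jacobiMoment_zero_cons, ih]
    ring

theorem replicate_count_zero_add_filter (s : Multiset ℕ) :
    Multiset.replicate (s.count 0) 0 + s.filter (· ≠ 0) = s := by
  rw [← Multiset.filter_eq', Multiset.filter_add_not]

/-- Each zero part contributes only the constant p_0 = N. -/
theorem exists_isRatCont_of_filter {s : Multiset ℕ}
    (h : ∃ c, IsRatCont (jacobiMoment N (s.filter (· ≠ 0))) a b c) :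
    ∃ c, IsRatCont (jacobiMoment N s) a b c := by
  obtain ⟨c, hc⟩ := h
  refine ⟨_, ((isRatCont_const ((N : ℝ) ^ s.count 0) a b).mul hc).congr fun x y _ _ => ?_⟩
  rw [← jacobiMoment_replicate_zero_add, replicate_count_zero_add_filter]

-- One loop equation is chosen for each partition of n + 1, giving a square system for the
-- top-degree averages.
open MvPolynomial in
theorem exists_isRatCont_jacobiMoment_succ {n : ℕ} (hc : (n : ℝ) < |a + b - 2 + 2 * N|)
    (ih : ∀ s : Multiset ℕ, s.sum = n → ∃ c, IsRatCont (jacobiMoment N s) a b c)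
    {s : Multiset ℕ} (hs : s ∈ partitionFinset (n + 1)) :
    ∃ c, IsRatCont (jacobiMoment N s) a b c := by
  have hd : ∀ s : partitionFinset (n + 1), ∃ (m : ℕ) (l : Multiset ℕ),
      s.1 = (m + 1) ::ₘ l ∧ m + l.sum = n ∧ 0 ∉ l :=
    fun s => exists_eq_cons_of_mem_partitionFinset s.2
  choose m l hml hn hl using hd
  let T : partitionFinset (n + 1) → Multiset (Multiset ℕ) := fun s =>
    cuts (m s) (l s) + joins (m s + 1) (l s)
  have hT : ∀ s, ∀ t ∈ T s, t ∈ partitionFinset (n + 1) := fun s t ht =>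
    (Multiset.mem_add.1 ht).elim (mem_partitionFinset_of_mem_cuts (hn s) (hl s))
      (mem_partitionFinset_of_mem_joins (hn s) (hl s))
  have hcard : ∀ s, (T s).card = n := fun s => by
    rw [Multiset.card_add, card_cuts, card_joins, hn]
  let M : Matrix (partitionFinset (n + 1)) (partitionFinset (n + 1)) (MvPolynomial (Fin 2) ℝ) :=
    fun s t => (if s = t then X 0 + X 1 + C (-2 + 2 * (N : ℝ)) else 0) + C ((T s).count t.1 : ℝ)
  have hM : ∀ x y s t, M.map (eval ![x, y]) s t =
      (if s = t then x + y - 2 + 2 * N else 0) + ((T s).count t.1 : ℝ) := fun x y s t => by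
    rw [Matrix.map_apply]
    split_ifs with h
    · simp [M, h]
      ring
    · simp [M, h]
  refine exists_isRatCont_of_mulVec M (fun s => jacobiMoment N s.1) (fun s x y =>
    (x - 1) * jacobiMoment N (m s ::ₘ l s) x y + ((Multiset.range (m s + 1)).map fun r =>
      jacobiMoment N (r ::ₘ (m s - r) ::ₘ l s) x y).sum +
      ((joins (m s) (l s)).map fun t => jacobiMoment N t x y).sum) ?_ ?_ ?_ ⟨s, hs⟩
  · refine det_ne_zero_of_sum_row_lt_diag fun s => ?_
    have h1 : ∑ t ∈ Finset.univ.erase s, ‖M.map (eval ![a, b]) s t‖ =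
        ∑ t ∈ Finset.univ.erase s, ((T s).count t.1 : ℝ) := by
      refine Finset.sum_congr rfl fun t ht => ?_
      rw [hM, if_neg (Finset.ne_of_mem_erase ht).symm, zero_add, Real.norm_natCast]
    have h2 : ((T s).count s.1 : ℝ) + ∑ t ∈ Finset.univ.erase s, ((T s).count t.1 : ℝ) = n := by
      rw [Finset.add_sum_erase _ (fun t => ((T s).count t.1 : ℝ)) (Finset.mem_univ s),
        Finset.sum_coe_sort (partitionFinset (n + 1)) fun t => ((T s).count t : ℝ),
        ← Nat.cast_sum, Multiset.sum_count_eq_card (hT s), hcard]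
    rw [h1, hM, if_pos rfl, Real.norm_eq_abs]
    -- A count on the diagonal lowers the diagonal entry by at most itself and leaves the
    -- off-diagonal sum by the same amount, so the bound by n suffices.
    have h3 := abs_sub_abs_le_abs_sub (a + b - 2 + 2 * N) (-((T s).count s.1 : ℝ))
    rw [abs_neg, Nat.abs_cast, sub_neg_eq_add] at h3
    linarith
  · intro x y hx hy s
    have h1 := jacobiMoment_loop (N := N) hx hy (m s) (l s)
    rw [← hml, add_assoc, ← Multiset.sum_add, ← Multiset.map_add] at h1
    rw [← h1, ← Multiset.sum_count_mul_eq_sum_map (hT s),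
      ← Finset.sum_coe_sort]
    simp only [Matrix.mulVec, dotProduct, hM, add_mul, Finset.sum_add_distrib, ite_mul, zero_mul,
      Finset.sum_ite_eq, Finset.mem_univ, if_true]
  · intro s
    obtain ⟨c1, h1⟩ := ih (m s ::ₘ l s) (by rw [Multiset.sum_cons, hn])
    have h2 : ∀ r ∈ Multiset.range (m s + 1), ∃ c,
        IsRatCont (jacobiMoment N (r ::ₘ (m s - r) ::ₘ l s)) a b c := fun r hr => by
      refine ih _ ?_
      have := Multiset.mem_range.1 hr
      have := hn s
      simp only [Multiset.sum_cons]
      omega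
    have h3 : ∀ t ∈ joins (m s) (l s), ∃ c, IsRatCont (jacobiMoment N t) a b c := fun t ht => by
      refine ih _ ?_
      rw [sum_of_mem_joins ht, add_comm, hn]
    choose! c2 h2 using h2
    choose! c3 h3 using h3
    exact ⟨_, ((((isRatCont_fst a b).sub_const 1).mul h1).add (isRatCont_multiset_sum h2)).add
      (isRatCont_multiset_sum h3)⟩

theorem exists_isRatCont_jacobiMoment (s : Multiset ℕ)
    (hc : (s.sum : ℝ) ≤ |a + b - 2 + 2 * N|) : ∃ c, IsRatCont (jacobiMoment N s) a b c := by
  obtain ⟨n, hn⟩ : ∃ n, s.sum = n := ⟨_, rfl⟩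
  rw [hn] at hc
  induction n generalizing s with
  | zero =>
    refine exists_isRatCont_of_filter ⟨1, ?_⟩
    have : s.filter (· ≠ 0) = 0 := by
      rw [Multiset.filter_eq_nil]
      exact fun j hj => not_not.2 (Multiset.sum_eq_zero_iff.1 hn j hj)
    rw [this]
    exact (isRatCont_const 1 a b).congr fun x y hx hy => (jacobiMoment_zero hx hy).symm
  | succ n ih =>
    push_cast at hc
    refine exists_isRatCont_of_filter (exists_isRatCont_jacobiMoment_succ (n := n) (by linarith)
      (fun t ht => ih t (by linarith) ht) (mem_partitionFinset.2 ⟨?_, by simp⟩))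
    rw [← hn]
    conv_rhs => rw [← replicate_count_zero_add_filter s]
    simp

end

/-! ### The large-N limit -/

theorem Multiset.abs_sum_map_le {α : Type*} {T : Multiset α} {f : α → ℝ} {B : ℝ}
    (h : ∀ t ∈ T, |f t| ≤ B) : |(T.map f).sum| ≤ T.card * B := by
  induction T using Multiset.induction with
  | empty => simp
  | cons t T ih =>
    have h1 := ih fun t' ht' => h t' (Multiset.mem_cons_of_mem ht')
    have h2 := h t (Multiset.mem_cons_self t T)
    rw [Multiset.map_cons, Multiset.sum_cons, Multiset.card_cons]
    push_cast
    linarith [abs_add_le (f t) (T.map f).sum]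

theorem Multiset.card_le_sum_of_zero_notMem {l : Multiset ℕ} (hl : 0 ∉ l) : l.card ≤ l.sum := by
  have := Multiset.card_nsmul_le_sum (s := l) (a := 1)
    fun x hx => Nat.one_le_iff_ne_zero.2 fun h => hl (h ▸ hx)
  simpa using this

/-- A priori bound for the top-degree part of the loop equations: with the weight `t ^ card` the
diagonal term dominates. -/
theorem abs_le_of_top_loop {n : ℕ} {v : Multiset ℕ → ℝ} {g t κ η D : ℝ} (ht : 1 ≤ t)
    (hη : 0 < η) (hκ : 0 ≤ κ) (hg : n / t + n * t * κ + η ≤ |g|)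
    (hD : ∀ m l, m + l.sum = n → 0 ∉ l → |g * v ((m + 1) ::ₘ l) + ((cuts m l).map v).sum +
      κ * ((joins (m + 1) l).map v).sum| ≤ D) {s : Multiset ℕ}
    (hs : s ∈ partitionFinset (n + 1)) : |v s| ≤ t ^ (n + 1) * (D / η) := by
  have ht0 : 0 < t := by linarith
  -- Maximum principle: the loop equation is used at the partition maximising the weighted size. A
  -- cut has one more part, which gains 1 / t; a join has one fewer, which costs t.
  obtain ⟨s₀, hs₀, hmax⟩ := Finset.exists_max_image (partitionFinset (n + 1))
    (fun s => t ^ s.card * |v s|) ⟨s, hs⟩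
  obtain ⟨m, l, rfl, hn, hl⟩ := exists_eq_cons_of_mem_partitionFinset hs₀
  have hD' := hD m l hn hl
  have hD0 : 0 ≤ D := (abs_nonneg _).trans hD'
  have hmn : (m : ℝ) ≤ n := by exact_mod_cast (by omega : m ≤ n)
  have hln : (l.sum : ℝ) ≤ n := by exact_mod_cast (by omega : l.sum ≤ n)
  set w := |v ((m + 1) ::ₘ l)| with hw
  have hw0 : 0 ≤ w := abs_nonneg _
  have hcut : ∀ x ∈ cuts m l, |v x| ≤ w / t := fun x hx => by
    have h := hmax x (mem_partitionFinset_of_mem_cuts hn hl hx)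
    rw [card_of_mem_cuts hx, Multiset.card_cons, pow_succ t (l.card + 1), mul_assoc] at h
    rw [le_div_iff₀ ht0, mul_comm]
    exact le_of_mul_le_mul_left h (pow_pos ht0 _)
  have hjoin : ∀ x ∈ joins (m + 1) l, |v x| ≤ t * w := fun x hx => by
    have h := hmax x (mem_partitionFinset_of_mem_joins hn hl hx)
    rw [card_of_mem_joins hx, Multiset.card_cons, pow_succ, mul_assoc] at h
    exact le_of_mul_le_mul_left h (pow_pos ht0 _)
  have h1 := Multiset.abs_sum_map_le hcut
  have h2 := Multiset.abs_sum_map_le hjoin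
  rw [card_cuts] at h1
  rw [card_joins] at h2
  set c := ((cuts m l).map v).sum
  set j := ((joins (m + 1) l).map v).sum
  have h1' : |c| ≤ n * (w / t) := h1.trans (by gcongr)
  have h2' : |κ * j| ≤ κ * (n * (t * w)) := by
    rw [abs_mul, abs_of_nonneg hκ]
    gcongr
    exact h2.trans (by gcongr)
  have h3 : |g| * w ≤ D + n * (w / t) + κ * (n * (t * w)) := by
    rw [hw, ← abs_mul]
    have e : g * v ((m + 1) ::ₘ l) = (g * v ((m + 1) ::ₘ l) + c + κ * j) - c - κ * j := by ring
    rw [e]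
    linarith [abs_sub (g * v ((m + 1) ::ₘ l) + c + κ * j - c) (κ * j),
      abs_sub (g * v ((m + 1) ::ₘ l) + c + κ * j) c]
  have h4 : w ≤ D / η := by
    rw [le_div_iff₀ hη]
    have h5 := mul_le_mul_of_nonneg_right hg hw0
    have h6 : (n / t + n * t * κ + η) * w = n * (w / t) + κ * (n * (t * w)) + w * η := by ring
    linarith
  have hk : l.card + 1 ≤ n + 1 := by
    have := Multiset.card_le_sum_of_zero_notMem hl
    omega
  calc |v s| ≤ t ^ s.card * |v s| := le_mul_of_one_le_left (abs_nonneg _) (one_le_pow₀ ht)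
    _ ≤ t ^ (l.card + 1) * w := by simpa using hmax s hs
    _ ≤ t ^ (n + 1) * (D / η) := by gcongr

/-- Stability of the system: only finitely many equations occur in a given degree, so their errors
become small simultaneously. -/
theorem tendsto_zero_of_top_loop {n : ℕ} {v : ℕ → Multiset ℕ → ℝ} {g : ℕ → ℝ} {γ : ℝ}
    (hγ : γ ≠ 0) (hg : Tendsto g atTop (𝓝 γ))
    (h : ∀ m l, m + l.sum = n → 0 ∉ l → Tendsto (fun N : ℕ => g N * v N ((m + 1) ::ₘ l) +
      ((cuts m l).map (v N)).sum + ((N : ℝ) ^ 2)⁻¹ * ((joins (m + 1) l).map (v N)).sum)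
      atTop (𝓝 0)) {s : Multiset ℕ} (hs : s ∈ partitionFinset (n + 1)) :
    Tendsto (fun N => v N s) atTop (𝓝 0) := by
  have hγ' : 0 < |γ| := abs_pos.2 hγ
  -- The budget is |γ|/4 for cuts, |γ|/8 for joins and |γ|/8 for η, within |γ|/2 ≤ |g N|.
  obtain ⟨t, ht1, ht⟩ : ∃ t : ℝ, 1 ≤ t ∧ n / t ≤ |γ| / 4 := by
    refine ⟨max 1 (4 * n / |γ|), le_max_left _ _, ?_⟩
    rw [div_le_iff₀ (by positivity)]
    calc (n : ℝ) = |γ| / 4 * (4 * n / |γ|) := by field_simp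
      _ ≤ _ := by gcongr; exact le_max_right _ _
  have hκ : Tendsto (fun N : ℕ => ((N : ℝ) ^ 2)⁻¹) atTop (𝓝 0) :=
    ((tendsto_pow_atTop two_ne_zero).comp tendsto_natCast_atTop_atTop).inv_tendsto_atTop
  have hsmall : ∀ᶠ N : ℕ in atTop, n * t * ((N : ℝ) ^ 2)⁻¹ ≤ |γ| / 8 := by
    have := hκ.const_mul (n * t)
    rw [mul_zero] at this
    exact this.eventually_le_const (by positivity)
  have hbig : ∀ᶠ N : ℕ in atTop, |γ| / 2 ≤ |g N| :=
    hg.abs.eventually_const_le (by linarith)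
  rw [Metric.tendsto_nhds]
  intro ε hε
  have hδ : ∀ᶠ N : ℕ in atTop, ∀ m ∈ Finset.range (n + 1), ∀ l ∈ partitionFinset (n - m),
      |g N * v N ((m + 1) ::ₘ l) + ((cuts m l).map (v N)).sum +
        ((N : ℝ) ^ 2)⁻¹ * ((joins (m + 1) l).map (v N)).sum| ≤
      ε / 2 / t ^ (n + 1) * (|γ| / 8) := by
    rw [Finset.eventually_all]
    intro m hm
    rw [Finset.eventually_all]
    intro l hl
    have hm := Finset.mem_range.1 hm
    obtain ⟨h1, h2⟩ := mem_partitionFinset.1 hl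
    have := (h m l (by omega) h2).abs
    rw [abs_zero] at this
    exact this.eventually_le_const (by positivity)
  filter_upwards [hsmall, hbig, hδ] with N h1 h2 h3
  have := abs_le_of_top_loop (v := v N) (g := g N) (κ := ((N : ℝ) ^ 2)⁻¹) (η := |γ| / 8) ht1
    (by positivity) (by positivity) (by linarith) (fun m l hn hl => h3 m
      (Finset.mem_range.2 (by omega)) l (mem_partitionFinset.2 ⟨by omega, hl⟩)) hs
  rw [Real.dist_0_eq_abs]
  refine this.trans_lt ?_
  rw [mul_div_cancel_right₀ _ (by positivity), mul_div_cancel₀ _ (by positivity)]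
  linarith

/-- The products of μ solve the limiting system exactly, being `hμ` times a common factor. So, by
induction on the degree, the difference from them satisfies the top-degree equations with vanishing
error. -/
theorem tendsto_of_loop {u : ℕ → Multiset ℕ → ℝ} {g A : ℕ → ℝ} {γ α : ℝ} {μ : ℕ → ℝ}
    (hγ : γ ≠ 0) (hg : Tendsto g atTop (𝓝 γ)) (hA : Tendsto A atTop (𝓝 α)) (hμ0 : μ 0 = 1)
    (hμ : ∀ m, γ * μ (m + 1) + ∑ s ∈ Finset.range m, μ (s + 1) * μ (m - s) =
      α * μ m + ∑ s ∈ Finset.range (m + 1), μ s * μ (m - s))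
    (h0 : ∀ᶠ N in atTop, u N 0 = 1) (hz : ∀ s, ∀ᶠ N in atTop, u N (0 ::ₘ s) = u N s)
    (hloop : ∀ m l, ∀ᶠ N : ℕ in atTop, g N * u N ((m + 1) ::ₘ l) + ((cuts m l).map (u N)).sum +
        ((N : ℝ) ^ 2)⁻¹ * ((joins (m + 1) l).map (u N)).sum =
      A N * u N (m ::ₘ l) +
        ((Multiset.range (m + 1)).map fun s => u N (s ::ₘ (m - s) ::ₘ l)).sum +
        ((N : ℝ) ^ 2)⁻¹ * ((joins m l).map (u N)).sum) (s : Multiset ℕ) :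
    Tendsto (fun N => u N s) atTop (𝓝 (s.map μ).prod) := by
  have hfil : ∀ s : Multiset ℕ, Tendsto (fun N => u N (s.filter (· ≠ 0))) atTop
      (𝓝 ((s.filter (· ≠ 0)).map μ).prod) → Tendsto (fun N => u N s) atTop
      (𝓝 (s.map μ).prod) := by
    intro s hs
    rw [← replicate_count_zero_add_filter s]
    generalize s.filter (· ≠ 0) = t at hs ⊢
    induction s.count 0 with
    | zero => simpa using hs
    | succ k ih =>
      rw [Multiset.replicate_succ, Multiset.cons_add, Multiset.map_cons, Multiset.prod_cons, hμ0,
        one_mul]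
      exact ih.congr' ((hz _).mono fun N h => h.symm)
  obtain ⟨n, hn⟩ : ∃ n, s.sum = n := ⟨_, rfl⟩
  induction n generalizing s with
  | zero =>
    refine hfil s ?_
    have : s.filter (· ≠ 0) = 0 := by
      rw [Multiset.filter_eq_nil]
      exact fun j hj => not_not.2 (Multiset.sum_eq_zero_iff.1 hn j hj)
    rw [this]
    exact tendsto_const_nhds.congr' (h0.mono fun N h => by simp [h])
  | succ n ih =>
    refine hfil s ?_
    have hs : s.filter (· ≠ 0) ∈ partitionFinset (n + 1) := by
      refine mem_partitionFinset.2 ⟨?_, by simp⟩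
      rw [← hn]
      conv_rhs => rw [← replicate_count_zero_add_filter s]
      simp
    have hκ : Tendsto (fun N : ℕ => ((N : ℝ) ^ 2)⁻¹) atTop (𝓝 0) :=
      ((tendsto_pow_atTop two_ne_zero).comp tendsto_natCast_atTop_atTop).inv_tendsto_atTop
    let ρ : Multiset ℕ → ℝ := fun s => (s.map μ).prod
    suffices h : Tendsto (fun N => u N (s.filter (· ≠ 0)) - ρ (s.filter (· ≠ 0))) atTop (𝓝 0) by
      simpa using h.add_const (ρ (s.filter (· ≠ 0)))
    refine tendsto_zero_of_top_loop (v := fun N s => u N s - ρ s) hγ hg (fun m l hml hl => ?_) hs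
    have e1 := ih (m ::ₘ l) (by rw [Multiset.sum_cons, hml])
    have e2 : Tendsto (fun N => ((Multiset.range (m + 1)).map
        fun s => u N (s ::ₘ (m - s) ::ₘ l)).sum) atTop (𝓝 ((Multiset.range (m + 1)).map
        fun s => ρ (s ::ₘ (m - s) ::ₘ l)).sum) :=
      tendsto_multiset_sum _ fun r hr => ih _ (by
        have := Multiset.mem_range.1 hr
        simp only [Multiset.sum_cons]
        omega)
    have e3 : Tendsto (fun N => ((joins m l).map (u N)).sum) atTop
        (𝓝 ((joins m l).map ρ).sum) :=
      tendsto_multiset_sum _ fun r hr => ih _ (by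
        rw [sum_of_mem_joins hr, add_comm, hml])
    have e4 := (((hA.mul e1).add e2).add (hκ.mul e3)).sub
      (((hg.mul_const (ρ ((m + 1) ::ₘ l))).add_const ((cuts m l).map ρ).sum).add
        (hκ.mul_const ((joins (m + 1) l).map ρ).sum))
    have e5 : α * (Multiset.map μ (m ::ₘ l)).prod + ((Multiset.range (m + 1)).map
        fun s => ρ (s ::ₘ (m - s) ::ₘ l)).sum + 0 * ((joins m l).map ρ).sum -
        (γ * ρ ((m + 1) ::ₘ l) + ((cuts m l).map ρ).sum +
          0 * ((joins (m + 1) l).map ρ).sum) = 0 := by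
      have hr : ((Multiset.range (m + 1)).map fun s => ρ (s ::ₘ (m - s) ::ₘ l)).sum =
          (∑ s ∈ Finset.range (m + 1), μ s * μ (m - s)) * ρ l := by
        rw [Finset.sum_mul, Finset.sum, Finset.range_val]
        simp [ρ, mul_assoc]
      have hc : ((cuts m l).map ρ).sum =
          (∑ s ∈ Finset.range m, μ (s + 1) * μ (m - s)) * ρ l := by
        rw [Finset.sum_mul, Finset.sum, Finset.range_val, cuts, Multiset.map_map]
        simp [ρ, mul_assoc]
      rw [hr, hc]
      simp only [ρ, Multiset.map_cons, Multiset.prod_cons]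
      linear_combination (-(l.map μ).prod) * hμ m
    rw [e5] at e4
    refine e4.congr' ((hloop m l).mono fun N hN => ?_)
    simp only [Multiset.sum_map_sub]
    rw [← hN]
    ring

/-- Large-`N` limit of the rational continuations of the normalised averages. -/
theorem tendsto_jacobiMoment {a b : ℕ → ℝ} {α β : ℝ} {μ : ℕ → ℝ}
    (ha : Tendsto (fun N => a N / N) atTop (𝓝 α)) (hb : Tendsto (fun N => b N / N) atTop (𝓝 β))
    (hαβ : α + β + 2 ≠ 0) (hμ0 : μ 0 = 1)
    (hμ : ∀ m, (α + β + 2) * μ (m + 1) + ∑ s ∈ Finset.range m, μ (s + 1) * μ (m - s) =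
      α * μ m + ∑ s ∈ Finset.range (m + 1), μ s * μ (m - s)) :
    (∀ s, ∀ᶠ N in atTop, ∃ c, IsRatCont (jacobiMoment N s) (a N) (b N) c) ∧
    ∀ (s) (w : ℕ → ℝ), (∀ᶠ N in atTop, IsRatCont (jacobiMoment N s) (a N) (b N) (w N)) →
      Tendsto (fun N => w N / (N : ℝ) ^ s.card) atTop (𝓝 (s.map μ).prod) := by
  classical
  have hinv := tendsto_inv_atTop_nhds_zero_nat (𝕜 := ℝ)
  have hA : Tendsto (fun N => (a N - 1) / N) atTop (𝓝 α) := by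
    simpa [sub_div] using ha.sub hinv
  have hg : Tendsto (fun N => (a N + b N - 2 + 2 * N) / N) atTop (𝓝 (α + β + 2)) := by
    have := ((ha.add hb).sub (hinv.const_mul 2)).add_const 2
    rw [mul_zero, sub_zero] at this
    refine this.congr' ((eventually_ne_atTop 0).mono fun N hN => ?_)
    have : (N : ℝ) ≠ 0 := by exact_mod_cast hN
    field_simp
  have hlarge : Tendsto (fun N : ℕ => |a N + b N - 2 + 2 * N|) atTop atTop := by
    refine (hg.abs.pos_mul_atTop (abs_pos.2 hαβ) tendsto_natCast_atTop_atTop).congr'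
      ((eventually_ne_atTop 0).mono fun N hN => ?_)
    have : (N : ℝ) ≠ 0 := by exact_mod_cast hN
    rw [abs_div, Nat.abs_cast, div_mul_cancel₀ _ this]
  have hex : ∀ s, ∀ᶠ N in atTop, ∃ c, IsRatCont (jacobiMoment N s) (a N) (b N) c := fun s =>
    (hlarge.eventually_ge_atTop (s.sum : ℝ)).mono fun N h => exists_isRatCont_jacobiMoment s h
  refine ⟨hex, fun s w hw => ?_⟩
  -- For each fixed s the default 0 occurs for only finitely many N.
  let W : ℕ → Multiset ℕ → ℝ := fun N s =>
    if h : ∃ c, IsRatCont (jacobiMoment N s) (a N) (b N) c then h.choose else 0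
  have hW : ∀ s, ∀ᶠ N in atTop, IsRatCont (jacobiMoment N s) (a N) (b N) (W N s) := fun s =>
    (hex s).mono fun N h => by
      simp only [W, dif_pos h]
      exact h.choose_spec
  have hWall : ∀ T : Multiset (Multiset ℕ), ∀ᶠ N in atTop, ∀ t ∈ T,
      IsRatCont (jacobiMoment N t) (a N) (b N) (W N t) := fun T => by
    have := (Finset.eventually_all T.toFinset).2 fun t _ => hW t
    simpa using this
  refine (tendsto_of_loop (u := fun N s => W N s / (N : ℝ) ^ s.card) hαβ hg hA hμ0 hμ ?_ ?_ ?_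
    s).congr' ?_
  · filter_upwards [hW 0] with N h0
    rw [h0.unique ((isRatCont_const 1 _ _).congr fun x y hx hy => (jacobiMoment_zero hx hy).symm)]
    simp
  · intro s
    filter_upwards [hW s, hW (0 ::ₘ s), eventually_ne_atTop 0] with N h1 h2 hN
    have : (N : ℝ) ≠ 0 := by exact_mod_cast hN
    rw [h2.unique (((isRatCont_const (N : ℝ) _ _).mul h1).congr
      fun x y _ _ => (jacobiMoment_zero_cons s).symm), Multiset.card_cons, pow_succ']
    field_simp
  · intro m l
    filter_upwards [hW ((m + 1) ::ₘ l), hWall (cuts m l), hWall (joins (m + 1) l), hW (m ::ₘ l),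
      hWall ((Multiset.range (m + 1)).map fun s => s ::ₘ (m - s) ::ₘ l), hWall (joins m l),
      eventually_ne_atTop 0] with N h1 h2 h3 h4 h5 h6 hN
    have hN' : (N : ℝ) ≠ 0 := by exact_mod_cast hN
    have hcoef : IsRatCont (fun x y => x + y - 2 + 2 * N) (a N) (b N)
        (a N + b N - 2 + 2 * N) :=
      (((isRatCont_fst _ _).add (isRatCont_snd _ _)).sub_const 2).add (isRatCont_const _ _ _)
    have hL := ((hcoef.mul h1).add (isRatCont_multiset_sum h2)).add (isRatCont_multiset_sum h3)
    have hR := ((((isRatCont_fst (a N) (b N)).sub_const 1).mul h4).add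
      (isRatCont_multiset_sum h5)).add (isRatCont_multiset_sum h6)
    -- Uniqueness of continuation carries the loop equation from the quadrant to (a N, b N).
    have key := hL.unique (hR.congr fun x y hx hy => by
      rw [jacobiMoment_loop hx hy, Multiset.map_map]
      rfl)
    have hs : ∀ (T : Multiset (Multiset ℕ)) (d : ℕ), (∀ t ∈ T, t.card = d) →
        (T.map fun s => W N s / (N : ℝ) ^ s.card).sum = (T.map (W N)).sum / (N : ℝ) ^ d :=
      fun T d hT => by
        rw [← Multiset.sum_map_div]
        exact congrArg _ (Multiset.map_congr rfl fun t ht => by rw [hT t ht])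
    have hrange : ((Multiset.range (m + 1)).map fun s => W N (s ::ₘ (m - s) ::ₘ l) /
        (N : ℝ) ^ (s ::ₘ (m - s) ::ₘ l).card).sum =
        (((Multiset.range (m + 1)).map fun s => s ::ₘ (m - s) ::ₘ l).map (W N)).sum /
          (N : ℝ) ^ (l.card + 2) := by
      rw [← hs _ (l.card + 2), Multiset.map_map]
      · rfl
      · intro t ht
        obtain ⟨r, -, rfl⟩ := Multiset.mem_map.1 ht
        simp
    -- The equation is divided by N^(l.card + 2): joins have only l.card parts, hence their N⁻².
    rw [hrange, hs _ _ fun t ht => card_of_mem_cuts ht, hs _ _ fun t ht => card_of_mem_joins ht,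
      hs _ _ fun t ht => card_of_mem_joins ht, Multiset.card_cons, Multiset.card_cons]
    rw [pow_add, pow_add]
    field_simp
    linear_combination key
  · filter_upwards [hW s, hw] with N h1 h2
    rw [h1.unique h2]

/-! ### The two degenerate slopes -/

theorem mainTheorem5 (k : ℕ) (hk : 0 < k) (a₀ a₁ b₀ b₁ : ℝ) :
    (a₁ = -1 → b₁ ≠ -1 →
      (∀ᶠ N : ℕ in atTop, ∃! c, IsContinuedRatio N k (a₁ * N + a₀) (b₁ * N + b₀) c) ∧
      Tendsto (fun N : ℕ => selbergI N k (a₁ * N + a₀) (b₁ * N + b₀) / (N : ℝ)) atTop (𝓝 0)) ∧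
    (b₁ = -1 → a₁ ≠ -1 →
      (∀ᶠ N : ℕ in atTop, ∃! c, IsContinuedRatio N k (a₁ * N + a₀) (b₁ * N + b₀) c) ∧
      Tendsto (fun N : ℕ => selbergI N k (a₁ * N + a₀) (b₁ * N + b₀) / (N : ℝ)) atTop (𝓝 1)) := by
  have hlin : ∀ x y : ℝ, Tendsto (fun N : ℕ => (x * N + y) / N) atTop (𝓝 x) := fun x y => by
    have := ((tendsto_inv_atTop_nhds_zero_nat (𝕜 := ℝ)).const_mul y).const_add x
    rw [mul_zero, add_zero] at this
    refine this.congr' ((eventually_ne_atTop 0).mono fun N hN => ?_)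
    have : (N : ℝ) ≠ 0 := by exact_mod_cast hN
    field_simp
  have main : ∀ μ : ℕ → ℝ, a₁ + b₁ + 2 ≠ 0 → μ 0 = 1 →
      (∀ m, (a₁ + b₁ + 2) * μ (m + 1) + ∑ s ∈ Finset.range m, μ (s + 1) * μ (m - s) =
        a₁ * μ m + ∑ s ∈ Finset.range (m + 1), μ s * μ (m - s)) →
      (∀ᶠ N : ℕ in atTop, ∃! c, IsContinuedRatio N k (a₁ * N + a₀) (b₁ * N + b₀) c) ∧
      Tendsto (fun N : ℕ => selbergI N k (a₁ * N + a₀) (b₁ * N + b₀) / (N : ℝ)) atTop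
        (𝓝 (μ k)) := by
    intro μ h1 h2 h3
    obtain ⟨hex, hlim⟩ := tendsto_jacobiMoment (hlin a₁ a₀) (hlin b₁ b₀) h1 h2 h3
    constructor
    · filter_upwards [hex {k}] with N ⟨c, hc⟩
      exact ⟨c, isContinuedRatio_iff.2 hc, fun d hd => (isContinuedRatio_iff.1 hd).unique hc⟩
    · have := hlim {k} (fun N => selbergI N k (a₁ * N + a₀) (b₁ * N + b₀)) (by
        filter_upwards [hex {k}] with N hc
        simp only [← isContinuedRatio_iff] at hc ⊢
        rw [selbergI, dif_pos hc]
        exact hc.choose_spec)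
      simpa using this
  constructor
  · rintro rfl hb
    -- At m = 0 the right side is a₁ + 1 = 0; for m > 0 every term vanishes.
    have := main (fun j => if j = 0 then 1 else 0) (fun h => hb (by linarith)) rfl fun m => by
      rw [Finset.sum_eq_zero (s := Finset.range m), Finset.sum_range_succ']
      · rcases m with _ | m <;> simp
      · intro s _
        simp
    simpa [hk.ne'] using this
  · rintro rfl ha
    -- With b₁ = -1 the recursion reads (a₁ + 1) + m = a₁ + (m + 1).
    refine main (fun _ => 1) (fun h => ha (by linarith)) rfl fun m => ?_
    simp
    ring
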